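/- Let $0\le n\le 3$, let $\widehat{\mathcal O}=\mathbb C[\![x_1,\dots,x_n]\!]$ with maximal ideal $\mathfrak m$, and let $\mathrm{Der}=\mathrm{Der}_{\mathbb C}\widehat{\mathcal O}$ be the module of $\mathbb C$-linear derivations of $\widehat{\mathcal O}$, with the commutator bracket. For $f\in\widehat{\mathcal O}$ let $\mathrm{Der}_f=\{\delta\in\mathrm{Der}\mid \delta(\widehat{\mathcal O} f)\subseteq\widehat{\mathcal O} f\}$. Suppose that $f$ is free, that is, $f$ is reduced (nonzero and square-free) and there are $\delta_1,\dots,\delta_n\in\mathrm{Der}_f$ with $\det(\delta_i(x_j))_{i,j}\in\widehat{\mathcal O}^{*}\cdot f$; and suppose that $f$ is not a product with a smooth factor, that is, $\mathrm{Der}_f\subseteq\mathfrak m\cdot\mathrm{Der}$. (In this case $\mathfrak m^d\cdot\mathrm{Der}_f$ is a Lie ideal of $\mathrm{Der}_f$.) Then for every $d\ge 1$ the Lie algebra $\mathfrak D_d=\mathrm{Der}_f/\mathfrak m^d\cdot\mathrm{Der}_f$ over $\mathbb C$ is solvable. -/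

import Mathlib

/-- The ring of formal power series over `ℂ` in `n` variables. -/
abbrev FormalRing (n : ℕ) : Type := MvPowerSeries (Fin n) ℂ

/-- The module of formal vector fields: the `ℂ`-linear derivations of the ring of formal power
series, with its commutator bracket. -/
abbrev FormalDer (n : ℕ) : Type := Derivation ℂ (FormalRing n) (FormalRing n)

namespace FormalDer

/-- The maximal ideal of the ring of formal power series. -/
noncomputable abbrev maxIdeal (n : ℕ) : Ideal (FormalRing n) :=
  IsLocalRing.maximalIdeal (FormalRing n)

/-- The module of logarithmic vector fields of `f`: the vector fields that preserve the
principal ideal generated by `f`. -/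
def logModule {n : ℕ} (f : FormalRing n) : Submodule (FormalRing n) (FormalDer n) where
  carrier := {δ | ∀ g ∈ Ideal.span {f}, δ g ∈ Ideal.span {f}}
  add_mem' {a b} ha hb g hg := by
    simpa using Ideal.add_mem _ (ha g hg) (hb g hg)
  zero_mem' g _ := by simp
  smul_mem' c a ha g hg := by
    simpa using Ideal.mul_mem_left _ c (ha g hg)

/-- The logarithmic vector fields of `f` as a Lie algebra over `ℂ`. -/
def logDer {n : ℕ} (f : FormalRing n) : LieSubalgebra ℂ (FormalDer n) where
  carrier := {δ | δ ∈ logModule f}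
  add_mem' ha hb := (logModule f).add_mem ha hb
  zero_mem' := (logModule f).zero_mem
  smul_mem' c a ha := (logModule f).smul_of_tower_mem c ha
  lie_mem' {a b} ha hb g hg := by
    rw [Derivation.commutator_apply]
    exact Ideal.sub_mem _ (ha _ (hb g hg)) (hb _ (ha g hg))

/-- `f` is a product (with a smooth factor) if some logarithmic vector field of `f` is not
in `𝔪 · Der`, that is, does not vanish at the origin. -/
def IsProduct {n : ℕ} (f : FormalRing n) : Prop :=
  ¬ logModule f ≤ maxIdeal n • (⊤ : Submodule (FormalRing n) (FormalDer n))

/-- A reduced `f` is free if there are logarithmic vector fields `δ₁, …, δₙ` of `f` such that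
the determinant of the matrix with entries `δᵢ(xⱼ)` is a unit times `f`. -/
def IsFree {n : ℕ} (f : FormalRing n) : Prop :=
  Squarefree f ∧ ∃ δ : Fin n → FormalDer n, (∀ i, δ i ∈ logModule f) ∧
    ∃ u : (FormalRing n)ˣ,
      (Matrix.of fun i j => δ i (MvPowerSeries.X j)).det = (u : FormalRing n) * f

theorem apply_mem_of_mem_smul_top {n : ℕ} {I : Ideal (FormalRing n)} {δ : FormalDer n}
    (h : δ ∈ I • (⊤ : Submodule (FormalRing n) (FormalDer n))) (g : FormalRing n) : δ g ∈ I := by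
  induction h using Submodule.smul_induction_on' with
  | smul r hr η _ => simpa using I.mul_mem_right (η g) hr
  | add a _ b _ ha hb => simpa using I.add_mem ha hb

theorem apply_mem_pow {n : ℕ} {I : Ideal (FormalRing n)} {δ : FormalDer n}
    (h : ∀ g, δ g ∈ I) (d : ℕ) : ∀ g ∈ I ^ d, δ g ∈ I ^ d := by
  induction d with
  | zero => simp
  | succ d ih =>
    intro g hg
    rw [pow_succ] at hg ⊢
    induction hg using Submodule.mul_induction_on' with
    | mem_mul_mem a ha b hb =>
      rw [Derivation.leibniz, smul_eq_mul, smul_eq_mul, mul_comm b]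
      exact Ideal.add_mem _ (Ideal.mul_mem_mul ha (h b)) (Ideal.mul_mem_mul (ih a ha) hb)
    | add a _ b _ ha hb => simpa using Ideal.add_mem _ ha hb

theorem lie_mem_pow_smul {n : ℕ} {f : FormalRing n} (hf : ¬ IsProduct f) (d : ℕ)
    {δ η : FormalDer n} (hδ : δ ∈ logModule f) (hη : η ∈ maxIdeal n ^ d • logModule f) :
    ⁅δ, η⁆ ∈ maxIdeal n ^ d • logModule f := by
  have h1 : ∀ g, δ g ∈ maxIdeal n := apply_mem_of_mem_smul_top (not_not.mp hf hδ)
  induction hη using Submodule.smul_induction_on' with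
  | smul r hr ξ hξ =>
    have h2 : ⁅δ, r • ξ⁆ = δ r • ξ + r • ⁅δ, ξ⁆ := by
      refine Derivation.ext fun g => ?_
      simp only [Derivation.commutator_apply, Derivation.add_apply, Derivation.smul_apply,
        Derivation.leibniz, smul_eq_mul]
      ring
    rw [h2]
    exact Submodule.add_mem _ (Submodule.smul_mem_smul (apply_mem_pow h1 d r hr) hξ)
      (Submodule.smul_mem_smul hr ((logDer f).lie_mem hδ hξ))
  | add a _ b _ ha hb =>
    have h3 : ⁅δ, a + b⁆ = ⁅δ, a⁆ + ⁅δ, b⁆ := lie_add δ a b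
    rw [h3]
    exact Submodule.add_mem _ ha hb

/-- The submodule `𝔪ᵈ · Der_f` of `Der_f`; if `f` is not a product, it is a Lie ideal. -/
def truncIdeal {n : ℕ} (f : FormalRing n) (hf : ¬ IsProduct f) (d : ℕ) :
    LieIdeal ℂ (logDer f) where
  carrier := {δ | (δ : FormalDer n) ∈ maxIdeal n ^ d • logModule f}
  add_mem' ha hb := (maxIdeal n ^ d • logModule f).add_mem ha hb
  zero_mem' := (maxIdeal n ^ d • logModule f).zero_mem
  smul_mem' c _ ha := (maxIdeal n ^ d • logModule f).smul_of_tower_mem c ha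
  lie_mem {x _} hm := lie_mem_pow_smul hf d x.2 hm

/-- The truncated Lie algebra `Der_f / 𝔪ᵈ · Der_f` over `ℂ`, for `f` not a product. -/
abbrev Truncated {n : ℕ} (f : FormalRing n) (hf : ¬ IsProduct f) (d : ℕ) : Type :=
  logDer f ⧸ truncIdeal f hf d

end FormalDer

/-! Since `f` is not a product, bracketing with 𝔪·Der_f raises the 𝔪-adic order on Der_f by one, so
everything reduces to L = Der_f/𝔪·Der_f. By Saito's criterion (`logModule_eq_span`) the `δᵢ`
generate Der_f, hence dim L ≤ n ≤ 3. If L is not solvable, it is therefore perfect of dimension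
three.

Suppose that it is. For every unit multiple F of `f`, each logarithmic x satisfies x(F) = χ(x)F, and
the cofactor χ is a 1-cocycle with values in the power series. On the finite-dimensional pieces
𝔪^k/𝔪^(k+1) the action factors through L, so the first Whitehead lemma
(`exists_sub_lie_mem_of_cocycle`) allows F to be changed by a unit so that χ moves from 𝔪^k into
𝔪^(k+1). But if A is the matrix of the `δᵢ`, then A∇F = Fχ, while det A is F up to a unit.
Multiplying by the adjugate of A and cancelling F puts ∇F, and then `f`, into 𝔪^k. As k is
arbitrary, f = 0, a contradiction.

The Whitehead lemma is proved without classifying L, using the Casimir operator ∑ bᵢwᵢ with w the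
cyclic brackets of a basis b. Saito's criterion rests on unique factorization of power series, which
follows from Weierstrass preparation. -/

namespace MvPowerSeries

/-! ### Powers of the maximal ideal and the order of a power series -/

section MaximalIdeal

variable {n : ℕ} {K : Type*} [Field K]

theorem mem_maximalIdeal_iff {f : MvPowerSeries (Fin n) K} :
    f ∈ IsLocalRing.maximalIdeal (MvPowerSeries (Fin n) K) ↔ constantCoeff f = 0 := by
  rw [IsLocalRing.mem_maximalIdeal, mem_nonunits_iff, isUnit_iff_constantCoeff, isUnit_iff_ne_zero,
    not_not]

open Classical in
/-- Every power series of order greater than `k` is a combination of the variables with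
coefficients of order at least `k`. -/
theorem exists_eq_sum_X_mul {k : ℕ} {f : MvPowerSeries (Fin n) K}
    (hf : ∀ d : Fin n →₀ ℕ, d.degree < k + 1 → coeff d f = 0) :
    ∃ g : Fin n → MvPowerSeries (Fin n) K, f = ∑ i, X i * g i ∧
      ∀ i, ∀ d : Fin n →₀ ℕ, d.degree < k → coeff d (g i) = 0 := by
  -- `P i d` says that `i` is the first variable occurring in the monomial `d`. Each nonconstant
  -- monomial is thus assigned to exactly one variable.
  let P : Fin n → (Fin n →₀ ℕ) → Prop := fun i d => d i ≠ 0 ∧ ∀ j < i, d j = 0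
  let g : Fin n → MvPowerSeries (Fin n) K := fun i d =>
    if P i (d + Finsupp.single i 1) then coeff (d + Finsupp.single i 1) f else 0
  have hg : ∀ i d, coeff d (g i) =
    if P i (d + Finsupp.single i 1) then coeff (d + Finsupp.single i 1) f else 0 := fun _ _ => rfl
  have hX : ∀ i d, coeff d (X i * g i) = if P i d then coeff d f else 0 := by
    intro i d
    by_cases hi : d i = 0
    · rw [if_neg (fun h => h.1 hi), X, coeff_monomial_mul, if_neg]
      intro h
      have := h i
      simp [hi] at this
    · have hd : d - Finsupp.single i 1 + Finsupp.single i 1 = d :=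
        tsub_add_cancel_of_le (by simpa [Finsupp.single_le_iff] using Nat.one_le_iff_ne_zero.mpr hi)
      rw [X, coeff_monomial_mul, if_pos, one_mul, hg, hd]
      simpa [Finsupp.single_le_iff] using Nat.one_le_iff_ne_zero.mpr hi
  refine ⟨g, ?_, fun i d hd => ?_⟩
  · ext d
    rw [map_sum]
    simp_rw [hX]
    by_cases hd : d = 0
    · rw [hf d (by simp [hd])]
      simp
    · obtain ⟨i₀, hi₀⟩ : ∃ i, d i ≠ 0 := by
        by_contra! h
        exact hd (Finsupp.ext h)
      obtain ⟨i, hi⟩ : ∃ i, P i d := by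
        have hne : (Finset.univ.filter fun i => d i ≠ 0).Nonempty := ⟨i₀, by simp [hi₀]⟩
        refine ⟨Finset.min' _ hne, ?_, fun j hj => ?_⟩
        · simpa using Finset.min'_mem _ hne
        · by_contra h
          exact absurd (Finset.min'_le _ j (by simp [h])) (not_le.mpr hj)
      rw [Finset.sum_eq_single i, if_pos hi]
      · intro j _ hj
        rw [if_neg]
        rintro ⟨h1, h2⟩
        rcases lt_or_gt_of_ne hj with h | h
        · exact h1 (hi.2 j h)
        · exact hi.1 (h2 i h)
      · simp
  · rw [hg]
    split_ifs
    · exact hf _ (by simpa using hd)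
    · rfl

theorem mem_maximalIdeal_pow_iff {k : ℕ} {f : MvPowerSeries (Fin n) K} :
    f ∈ IsLocalRing.maximalIdeal (MvPowerSeries (Fin n) K) ^ k ↔
      ∀ d : Fin n →₀ ℕ, d.degree < k → coeff d f = 0 := by
  constructor
  · intro hf
    suffices (k : ℕ∞) ≤ f.order from fun d hd =>
      coeff_of_lt_order (lt_of_lt_of_le (by exact_mod_cast hd) this)
    induction k generalizing f with
    | zero => simp
    | succ k ih =>
      rw [pow_succ] at hf
      induction hf using Submodule.mul_induction_on' with
      | mem_mul_mem a ha b hb =>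
        rw [order_mul]
        push_cast
        exact add_le_add (ih ha) (one_le_order_iff_constCoeff_eq_zero.mpr
          (mem_maximalIdeal_iff.mp hb))
      | add a _ b _ ha hb => exact le_trans (le_min ha hb) min_order_le_add
  · intro hf
    induction k generalizing f with
    | zero => simp
    | succ k ih =>
      obtain ⟨g, rfl, hg⟩ := exists_eq_sum_X_mul hf
      rw [pow_succ']
      exact Ideal.sum_mem _ fun i _ => Ideal.mul_mem_mul (mem_maximalIdeal_iff.mpr (by simp))
        (ih (hg i))

theorem maximalIdeal_eq_span_X :
    IsLocalRing.maximalIdeal (MvPowerSeries (Fin n) K) = Ideal.span (Set.range X) := by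
  apply le_antisymm
  · intro f hf
    rw [← pow_one (IsLocalRing.maximalIdeal _), mem_maximalIdeal_pow_iff] at hf
    obtain ⟨g, rfl, -⟩ := exists_eq_sum_X_mul (k := 0) (by simpa using hf)
    exact Ideal.sum_mem _ fun i _ => Ideal.mul_mem_right _ _ (Ideal.subset_span ⟨i, rfl⟩)
  · rw [Ideal.span_le]
    rintro _ ⟨i, rfl⟩
    exact mem_maximalIdeal_iff.mpr (by simp)

/-- Completeness of the coefficient ring is what Weierstrass preparation requires. -/
instance isAdicComplete_maximalIdeal :
    IsAdicComplete (IsLocalRing.maximalIdeal (MvPowerSeries (Fin n) K))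
      (MvPowerSeries (Fin n) K) := by
  rw [maximalIdeal_eq_span_X]
  infer_instance

theorem eq_zero_of_forall_mem_maximalIdeal_pow {f : MvPowerSeries (Fin n) K}
    (hf : ∀ k, f ∈ IsLocalRing.maximalIdeal (MvPowerSeries (Fin n) K) ^ k) : f = 0 := by
  ext d
  exact mem_maximalIdeal_pow_iff.mp (hf (d.degree + 1)) d (Nat.lt_succ_self _)

end MaximalIdeal

end MvPowerSeries

/-! ### Weierstrass preparation and primality of irreducible series -/

namespace PowerSeries

variable {A : Type*} [CommRing A] [IsDomain A] [IsLocalRing A]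

/-- A monic factor of a distinguished polynomial that is a unit as a power series is trivial. -/
theorem _root_.Polynomial.isUnit_of_dvd_isDistinguishedAt {P a : Polynomial A}
    (hP : P.IsDistinguishedAt (IsLocalRing.maximalIdeal A)) (hdvd : a ∣ P)
    (ha : IsUnit (a : PowerSeries A)) : IsUnit a := by
  obtain ⟨b, rfl⟩ := hdvd
  have hlead : IsUnit a.leadingCoeff := by
    have := hP.monic
    rw [Polynomial.Monic, Polynomial.leadingCoeff_mul] at this
    exact IsUnit.of_mul_eq_one _ this
  -- Over the residue field `a` divides a power of `X`, so it is associated to some `X ^ i`. Its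
  -- constant term is a unit, which forces `i = 0`.
  let φ := IsLocalRing.residue A
  have hmap : (a.map φ) * (b.map φ) = Polynomial.X ^ (a * b).natDegree := by
    rw [← Polynomial.map_mul]
    exact hP.map_eq_X_pow
  obtain ⟨i, -, hi⟩ := (dvd_prime_pow Polynomial.prime_X _).mp (Dvd.intro _ hmap)
  have h0 : (a.map φ).coeff 0 ≠ 0 := by
    rw [Polynomial.coeff_map]
    have : IsUnit (a.coeff 0) := by
      have := PowerSeries.isUnit_iff_constantCoeff.mp ha
      simpa using this
    exact (this.map φ).ne_zero
  have hi0 : i = 0 := by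
    by_contra hne
    have : Polynomial.X ∣ a.map φ := (dvd_pow_self _ hne).trans hi.symm.dvd
    exact h0 (Polynomial.X_dvd_iff.mp this)
  rw [hi0, pow_zero] at hi
  have hdeg : a.natDegree = 0 := by
    have h1 : (a.map φ).natDegree = a.natDegree :=
      Polynomial.natDegree_map_of_leadingCoeff_ne_zero φ (hlead.map φ).ne_zero
    rw [← h1]
    exact Polynomial.natDegree_eq_zero_of_isUnit (associated_one_iff_isUnit.mp hi)
  rw [Polynomial.eq_C_of_natDegree_eq_zero hdeg] at hlead ⊢
  simpa using hlead

/-- Weierstrass preparation replaces `p` by a distinguished polynomial `P`, which stays irreducible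
in `A[X]`. There it is prime by unique factorization, and A[X]/(P) ≅ A[[X]]/(p) carries primality
back. -/
theorem prime_of_irreducible_of_map_residue_ne_zero [UniqueFactorizationMonoid A]
    [IsAdicComplete (IsLocalRing.maximalIdeal A) A] {p : PowerSeries A} (hp : Irreducible p)
    (hres : p.map (IsLocalRing.residue A) ≠ 0) : Prime p := by
  obtain ⟨P, h, H⟩ := p.exists_isWeierstrassFactorization hres
  have hassoc : Associated (P : PowerSeries A) p := by
    rw [H.eq_mul]
    exact (associated_mul_unit_right _ _ H.isUnit)
  have hirr : Irreducible (P : PowerSeries A) := hassoc.symm.irreducible hp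
  have hPirr : Irreducible P := by
    refine ⟨fun hu => hirr.not_isUnit ?_, fun a b hab => ?_⟩
    · exact hu.map (Polynomial.coeToPowerSeries.ringHom (R := A))
    · rcases hirr.isUnit_or_isUnit (a := a) (b := b) (by rw [hab, Polynomial.coe_mul]) with h | h
      · exact Or.inl (Polynomial.isUnit_of_dvd_isDistinguishedAt H.isDistinguishedAt
          (hab ▸ Dvd.intro _ rfl) h)
      · exact Or.inr (Polynomial.isUnit_of_dvd_isDistinguishedAt H.isDistinguishedAt
          (hab ▸ Dvd.intro_left _ rfl) h)
  have hPprime : (Ideal.span {P}).IsPrime :=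
    (Ideal.span_singleton_prime hPirr.ne_zero).mpr hPirr.prime
  have hdom : IsDomain (PowerSeries A ⧸ Ideal.span {p}) :=
    H.algEquivQuotient.symm.toMulEquiv.isDomain _
  exact (Ideal.span_singleton_prime hp.ne_zero).mp ((Ideal.Quotient.isDomain_iff_prime _).mp hdom)

end PowerSeries

namespace MvPowerSeries

instance isDomain {σ R : Type*} [CommRing R] [IsDomain R] : IsDomain (MvPowerSeries σ R) :=
  NoZeroDivisors.to_isDomain _

/-! ### Linear changes of coordinates and unique factorization -/

section LinearChange

variable {n : ℕ} {K : Type*} [Field K]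

/-- The linear forms with coefficients the rows of a matrix. -/
noncomputable def linearForms (M : Matrix (Fin n) (Fin n) K) (i : Fin n) : MvPowerSeries (Fin n) K :=
  ∑ j, C (M i j) * X j

theorem hasSubst_linearForms (M : Matrix (Fin n) (Fin n) K) : HasSubst (linearForms M) :=
  hasSubst_of_constantCoeff_zero fun i => by simp [linearForms]

theorem linearForms_one : linearForms (1 : Matrix (Fin n) (Fin n) K) = X := by
  funext i
  simp [linearForms, Matrix.one_apply]

theorem subst_linearForms_linearForms (M N : Matrix (Fin n) (Fin n) K) (i : Fin n) :
    subst (linearForms N) (linearForms M i) = linearForms (M * N) i := by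
  rw [← substAlgHom_apply (R := K) (hasSubst_linearForms N), linearForms, map_sum]
  have h : ∀ j, substAlgHom (R := K) (hasSubst_linearForms N) (C (M i j) * X j) =
      C (M i j) * linearForms N j := by
    intro j
    rw [← smul_eq_C_mul, map_smul, substAlgHom_X, smul_eq_C_mul]
  simp_rw [h, linearForms, Finset.mul_sum, Matrix.mul_apply, map_sum, Finset.sum_mul, map_mul,
    mul_assoc]
  rw [Finset.sum_comm]

theorem subst_linearForms_subst (M N : Matrix (Fin n) (Fin n) K) (f : MvPowerSeries (Fin n) K) :
    subst (linearForms N) (subst (linearForms M) f) = subst (linearForms (M * N)) f := by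
  rw [subst_comp_subst_apply (hasSubst_linearForms M) (hasSubst_linearForms N)]
  congr 1
  funext i
  exact subst_linearForms_linearForms M N i

/-- The automorphism of the ring of power series given by an invertible linear change of
coordinates. -/
noncomputable def linearChange (M : Matrix (Fin n) (Fin n) K) (hM : IsUnit M.det) :
    MvPowerSeries (Fin n) K ≃ₐ[K] MvPowerSeries (Fin n) K :=
  AlgEquiv.ofAlgHom (substAlgHom (hasSubst_linearForms M)) (substAlgHom (hasSubst_linearForms M⁻¹))
    (by
      ext1 f
      simp only [AlgHom.comp_apply, substAlgHom_apply, AlgHom.id_apply]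
      rw [subst_linearForms_subst, Matrix.nonsing_inv_mul _ hM, linearForms_one, subst_self, id])
    (by
      ext1 f
      simp only [AlgHom.comp_apply, substAlgHom_apply, AlgHom.id_apply]
      rw [subst_linearForms_subst, Matrix.mul_nonsing_inv _ hM, linearForms_one, subst_self, id])

/-- Restriction of a power series to the first coordinate axis. -/
noncomputable def restrictAxis (n : ℕ) (K : Type*) [Field K] :
    MvPowerSeries (Fin (n + 1)) K →+* PowerSeries K :=
  (PowerSeries.map constantCoeff).comp (finSuccEquiv K n).toRingEquiv.toRingHom

theorem coeff_restrictAxis (f : MvPowerSeries (Fin (n + 1)) K) (m : ℕ) :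
    PowerSeries.coeff m (restrictAxis n K f) = coeff (Finsupp.single 0 m) f := by
  simp only [restrictAxis, RingHom.comp_apply, PowerSeries.coeff_map]
  change constantCoeff (PowerSeries.coeff m (finSuccEquiv K n f)) = _
  rw [← coeff_zero_eq_constantCoeff, coeff_coeff_finSuccEquiv]
  congr 2
  ext i
  refine Fin.cases ?_ (fun j => ?_) i <;> simp

theorem restrictAxis_linearForms (M : Matrix (Fin (n + 1)) (Fin (n + 1)) K) (i : Fin (n + 1)) :
    restrictAxis n K (linearForms M i) = PowerSeries.C (M i 0) * PowerSeries.X := by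
  ext m
  rw [coeff_restrictAxis, linearForms, map_sum, Finset.sum_eq_single 0]
  · rw [coeff_C_mul, coeff_X, PowerSeries.coeff_C_mul, PowerSeries.coeff_X]
    congr 1
    by_cases h : m = 1
    · simp [h]
    · rw [if_neg h, if_neg]
      intro h'
      simpa [h] using DFunLike.congr_fun h' 0
  · intro j _ hj
    rw [coeff_C_mul, coeff_X, if_neg, mul_zero]
    intro h
    have := DFunLike.congr_fun h j
    simp [hj] at this
  · simp

/-- On the first axis the `i`-th form becomes `M i 0` times the variable, so only monomials of
degree `r` contribute. The right side is the degree-`r` form of `f` evaluated at the first column of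
`M`. -/
theorem coeff_subst_linearForms (M : Matrix (Fin (n + 1)) (Fin (n + 1)) K)
    {f : MvPowerSeries (Fin (n + 1)) K} {r : ℕ} (hr : ∀ d : Fin (n + 1) →₀ ℕ, d.degree < r → coeff d f = 0) :
    coeff (Finsupp.single 0 r) (subst (linearForms M) f) =
      (truncTotal (r + 1) f).eval fun i => M i 0 := by
  have hterm : ∀ d : Fin (n + 1) →₀ ℕ,
      coeff (Finsupp.single 0 r) (d.prod fun s e => linearForms M s ^ e) =
        if d.degree = r then ∏ i, M i 0 ^ d i else 0 := by
    intro d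
    rw [← coeff_restrictAxis, Finsupp.prod_fintype _ _ (by simp), map_prod]
    simp_rw [map_pow, restrictAxis_linearForms, mul_pow, Finset.prod_mul_distrib,
      Finset.prod_pow_eq_pow_sum, ← map_pow, ← map_prod, PowerSeries.coeff_C_mul,
      PowerSeries.coeff_X_pow, ← Finsupp.degree_eq_sum]
    by_cases h : d.degree = r
    · simp [h]
    · rw [if_neg h, if_neg (Ne.symm h), mul_zero]
  rw [coeff_subst (hasSubst_linearForms M), MvPolynomial.eval_eq']
  rw [finsum_eq_sum_of_support_subset (s := (truncTotal (r + 1) f).support)]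
  · refine Finset.sum_congr rfl fun d hd => ?_
    rw [hterm]
    have hdr : d.degree < r + 1 := by
      by_contra h
      exact MvPolynomial.mem_support_iff.mp hd (coeff_truncTotal_eq_zero _ (not_lt.mp h))
    rw [coeff_truncTotal _ hdr]
    by_cases h : d.degree = r
    · rw [if_pos h, smul_eq_mul]
    · rw [hr d (by omega), zero_smul, zero_mul]
  · intro d hd
    rw [Function.mem_support, hterm] at hd
    have h1 : d.degree = r := by
      by_contra h
      exact hd (by rw [if_neg h, smul_zero])
    rw [Finset.mem_coe, MvPolynomial.mem_support_iff, coeff_truncTotal _ (by omega)]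
    intro h
    exact hd (by rw [h, zero_smul])

/-- After a suitable linear change of coordinates, a nonzero power series does not vanish on the
first coordinate axis. -/
theorem exists_linearChange_map_residue_ne_zero [Infinite K] {f : MvPowerSeries (Fin (n + 1)) K}
    (hf : f ≠ 0) : ∃ e : MvPowerSeries (Fin (n + 1)) K ≃ₐ[K] MvPowerSeries (Fin (n + 1)) K,
      (finSuccEquiv K n (e f)).map (IsLocalRing.residue _) ≠ 0 := by
  obtain ⟨d, hd, hdr⟩ := exists_coeff_ne_zero_and_order (ne_zero_iff_order_finite.mp hf)
  have hr : ∀ e : Fin (n + 1) →₀ ℕ, e.degree < d.degree → coeff e f = 0 := fun e he =>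
    coeff_of_lt_order (by rw [← hdr]; exact_mod_cast he)
  set q := truncTotal (d.degree + 1) f with hq
  have hq0 : q ≠ 0 := by
    intro h
    apply hd
    rw [← coeff_truncTotal f (Nat.lt_succ_self d.degree), ← hq, h, MvPolynomial.coeff_zero]
  -- The extra factor `X 0` also gives `c 0 ≠ 0`, which makes the identity matrix with first column
  -- replaced by `c` invertible.
  obtain ⟨c, hc⟩ : ∃ c : Fin (n + 1) → K, (q * MvPolynomial.X 0).eval c ≠ 0 := by
    by_contra! h
    exact mul_ne_zero hq0 (MvPolynomial.X_ne_zero 0) (MvPolynomial.funext fun c => by simp [h c])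
  rw [map_mul, MvPolynomial.eval_X] at hc
  let M : Matrix (Fin (n + 1)) (Fin (n + 1)) K := (1 : Matrix _ _ K).updateCol 0 c
  have hM : IsUnit M.det := by
    have : M.det = c 0 := by
      rw [← Matrix.cramer_apply, Matrix.cramer_one]
      rfl
    rw [this]
    exact (right_ne_zero_of_mul hc).isUnit
  refine ⟨linearChange M hM, fun h => left_ne_zero_of_mul hc ?_⟩
  have h1 := coeff_subst_linearForms M hr
  have h2 : (fun i => M i 0) = c := by
    funext i
    simp [M]
  rw [h2, ← hq, ← coeff_restrictAxis] at h1
  rw [← h1]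
  have h3 := congrArg (PowerSeries.coeff d.degree) h
  rw [PowerSeries.coeff_map, map_zero, IsLocalRing.residue_eq_zero_iff, mem_maximalIdeal_iff] at h3
  rw [coeff_restrictAxis, ← h3, ← coeff_zero_eq_constantCoeff, coeff_coeff_finSuccEquiv]
  simp only [linearChange, AlgEquiv.ofAlgHom_apply, substAlgHom_apply]
  congr 2
  ext i
  refine Fin.cases ?_ (fun j => ?_) i <;> simp

/-- Induction on the number of variables. After a linear change an irreducible series does not
vanish on the first axis, so it is prime as a series in one variable over the factorial ring in the
others. -/
instance uniqueFactorizationMonoid_fin [Infinite K] :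
    UniqueFactorizationMonoid (MvPowerSeries (Fin n) K) := by
  induction n with
  | zero =>
    exact (isEmptyEquiv (Fin 0) K).toMulEquiv.symm.uniqueFactorizationMonoid inferInstance
  | succ n ih =>
    refine { (inferInstance : IsCancelMulZero (MvPowerSeries (Fin (n + 1)) K)),
      (inferInstance : WfDvdMonoid (MvPowerSeries (Fin (n + 1)) K)) with
      irreducible_iff_prime := fun {p} => ⟨fun hp => ?_, Prime.irreducible⟩ }
    obtain ⟨e, he⟩ := exists_linearChange_map_residue_ne_zero hp.ne_zero
    let E := e.toMulEquiv.trans (finSuccEquiv K n).toMulEquiv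
    rw [← MulEquiv.prime_iff E]
    exact PowerSeries.prime_of_irreducible_of_map_residue_ne_zero
      ((MulEquiv.irreducible_iff E).mpr hp) he

end LinearChange

end MvPowerSeries

/-- Reduces divisibility by a reduced series to its prime factors, where cancellation is available.
-/
theorem UniqueFactorizationMonoid.dvd_of_squarefree_of_forall_prime_dvd {R : Type*} [CommRing R]
    [IsDomain R] [UniqueFactorizationMonoid R] {f x : R} (hf : Squarefree f)
    (h : ∀ p, Prime p → p ∣ f → p ∣ x) : f ∣ x := by
  induction f using WfDvdMonoid.induction_on_irreducible generalizing x with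
  | zero => exact absurd hf not_squarefree_zero
  | unit u hu => exact hu.dvd
  | mul a i _ hi ih =>
    obtain ⟨c, rfl⟩ := ih hf.of_mul_right fun p hp hpa => h p hp (hpa.mul_left i)
    rcases hi.prime.dvd_or_dvd (h i hi.prime (dvd_mul_right i a)) with ⟨b, rfl⟩ | ⟨b, rfl⟩
    · exact absurd (hf i ⟨b, by ring⟩) hi.not_isUnit
    · exact ⟨b, by ring⟩

/-! ### Derivations and partial derivatives of power series -/

namespace MvPowerSeries

variable {n : ℕ} {K : Type*} [Field K]

/-- A derivation of the ring of formal power series is determined by its values at the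
variables. -/
theorem derivation_eq_zero {D : Derivation K (MvPowerSeries (Fin n) K) (MvPowerSeries (Fin n) K)}
    (h : ∀ i, D (X i) = 0) : D = 0 := by
  ext1 g
  -- If g − g(0) = ∑ Xᵢaᵢ, then D g = ∑ Xᵢ D(aᵢ), so each round of induction gains one order.
  refine eq_zero_of_forall_mem_maximalIdeal_pow fun k => ?_
  induction k generalizing g with
  | zero => simp
  | succ k ih =>
    obtain ⟨a, ha, -⟩ := exists_eq_sum_X_mul (k := 0) (f := g - C (constantCoeff g)) (by
      intro d hd
      have : d = 0 := (Finsupp.degree_eq_zero_iff d).mp (by omega)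
      simp [this])
    have hg : D g = ∑ i, X i * D (a i) := by
      have hC : D (C (constantCoeff g)) = 0 := D.map_algebraMap _
      rw [← sub_add_cancel g (C (constantCoeff g)), map_add, hC, add_zero, ha, map_sum]
      simp [h]
    rw [hg, pow_succ']
    exact Ideal.sum_mem _ fun i _ => Ideal.mul_mem_mul (mem_maximalIdeal_iff.mpr (by simp)) (ih _)

theorem derivation_ext {D E : Derivation K (MvPowerSeries (Fin n) K) (MvPowerSeries (Fin n) K)}
    (h : ∀ i, D (X i) = E (X i)) : D = E :=
  sub_eq_zero.mp (derivation_eq_zero fun i => by simp [h i])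

theorem derivation_sum_apply {ι : Type*} (s : Finset ι)
    (D : ι → Derivation K (MvPowerSeries (Fin n) K) (MvPowerSeries (Fin n) K))
    (g : MvPowerSeries (Fin n) K) : (∑ i ∈ s, D i) g = ∑ i ∈ s, D i g := by
  have := map_sum (Derivation.coeFnAddMonoidHom (R := K) (A := MvPowerSeries (Fin n) K)
    (M := MvPowerSeries (Fin n) K)) D s
  exact (congrFun this g).trans (Finset.sum_apply _ _ _)

theorem derivation_apply_eq_sum
    (D : Derivation K (MvPowerSeries (Fin n) K) (MvPowerSeries (Fin n) K))
    (g : MvPowerSeries (Fin n) K) : D g = ∑ j, D (X j) * pderiv K j g := by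
  have h : D = ∑ j, D (X j) • pderiv K j := by
    refine derivation_ext fun i => ?_
    rw [derivation_sum_apply, Finset.sum_eq_single i]
    · simp
    · intro j _ hj
      simp [pderiv_X_of_ne hj.symm]
    · simp
  conv_lhs => rw [h]
  rw [derivation_sum_apply]
  rfl

/-- In characteristic zero, if all partial derivatives of `g` have order at least `k`, then `g`
agrees with its constant term up to order greater than `k`. -/
theorem coeff_eq_zero_of_pderiv_mem_pow [CharZero K] {k : ℕ} {g : MvPowerSeries (Fin n) K}
    (h : ∀ j, pderiv K j g ∈ IsLocalRing.maximalIdeal (MvPowerSeries (Fin n) K) ^ k)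
    {d : Fin n →₀ ℕ} (hd0 : d ≠ 0) (hd : d.degree ≤ k) : coeff d g = 0 := by
  obtain ⟨i, hi⟩ : ∃ i, d i ≠ 0 := by
    by_contra! h
    exact hd0 (Finsupp.ext h)
  obtain ⟨e, rfl⟩ : ∃ e, d = e + Finsupp.single i 1 :=
    ⟨d - Finsupp.single i 1, (tsub_add_cancel_of_le
      (by simpa [Finsupp.single_le_iff] using Nat.one_le_iff_ne_zero.mpr hi)).symm⟩
  have h1 := mem_maximalIdeal_pow_iff.mp (h i) e (by simp at hd; omega)
  rw [coeff_pderiv] at h1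
  exact (mul_eq_zero.mp h1).resolve_right (by exact_mod_cast Nat.succ_ne_zero (e i))

/-- A nonzero power series with vanishing constant term does not divide all its partial
derivatives. -/
theorem exists_not_dvd_pderiv [CharZero K] {p : MvPowerSeries (Fin n) K} (hp : p ≠ 0)
    (hu : ¬ IsUnit p) : ∃ j, ¬ p ∣ pderiv K j p := by
  by_contra! h
  obtain ⟨d, hd, hdr⟩ := exists_coeff_ne_zero_and_order (ne_zero_iff_order_finite.mp hp)
  have hmem : p ∈ IsLocalRing.maximalIdeal (MvPowerSeries (Fin n) K) ^ d.degree :=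
    mem_maximalIdeal_pow_iff.mpr fun e he =>
      coeff_of_lt_order (by rw [← hdr]; exact_mod_cast he)
  -- If `p` divided all its derivatives, they would have at least the order of `p`, and the lowest
  -- coefficients of `p` would vanish.
  refine hd (coeff_eq_zero_of_pderiv_mem_pow (fun j => Ideal.mem_of_dvd _ (h j) hmem) ?_ le_rfl)
  rintro rfl
  have := (IsLocalRing.mem_maximalIdeal p).mpr hu
  exact hd (mem_maximalIdeal_iff.mp this)

end MvPowerSeries

/-! ### Saito's criterion -/

namespace FormalDer

open MvPowerSeries

variable {n : ℕ} {f : FormalRing n}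

theorem mem_logModule_iff {δ : FormalDer n} : δ ∈ logModule f ↔ f ∣ δ f := by
  constructor
  · intro h
    exact Ideal.mem_span_singleton.mp (h f (Ideal.mem_span_singleton_self f))
  · intro h g hg
    obtain ⟨a, rfl⟩ := Ideal.mem_span_singleton.mp hg
    rw [Derivation.leibniz, smul_eq_mul, smul_eq_mul]
    exact Ideal.mem_span_singleton.mpr (dvd_add (dvd_mul_right f _) (h.mul_left a))

/-- With f = ph the Leibniz rule gives p ∣ h·δ(p), and p ∤ h because `f` is square-free. -/
theorem prime_dvd_apply_of_mem_logModule (hf : Squarefree f) {δ : FormalDer n}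
    (hδ : δ ∈ logModule f) {p : FormalRing n} (hp : Prime p) (hpf : p ∣ f) : p ∣ δ p := by
  obtain ⟨h, rfl⟩ := hpf
  have h1 : p ∣ δ (p * h) := (dvd_mul_right p h).trans (mem_logModule_iff.mp hδ)
  rw [Derivation.leibniz, smul_eq_mul, smul_eq_mul, dvd_add_right (dvd_mul_right p _)] at h1
  refine (hp.dvd_or_dvd h1).resolve_left ?_
  rintro ⟨b, rfl⟩
  exact hp.not_isUnit (hf p ⟨b, by ring⟩)

/-- The determinant of any `n` logarithmic vector fields of a reduced `f` is divisible by `f`. -/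
theorem dvd_det_of_mem_logModule (hf : Squarefree f) {δ : Fin n → FormalDer n}
    (hδ : ∀ i, δ i ∈ logModule f) :
    f ∣ (Matrix.of fun i j => δ i (MvPowerSeries.X j)).det := by
  refine UniqueFactorizationMonoid.dvd_of_squarefree_of_forall_prime_dvd hf fun p hp hpf => ?_
  set A : Matrix (Fin n) (Fin n) (FormalRing n) := Matrix.of fun i j => δ i (MvPowerSeries.X j)
  -- Modulo `p` the gradient of `p` is a nonzero vector killed by `A`, so `p` divides `det A`.
  obtain ⟨j, hj⟩ := exists_not_dvd_pderiv hp.ne_zero hp.not_isUnit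
  have hA : ∀ i, p ∣ A.mulVec (fun j => pderiv ℂ j p) i := fun i => by
    have := prime_dvd_apply_of_mem_logModule hf (hδ i) hp hpf
    rwa [derivation_apply_eq_sum] at this
  have h1 : A.det • (fun j => pderiv ℂ j p) =
      A.adjugate.mulVec (A.mulVec fun j => pderiv ℂ j p) := by
    rw [Matrix.mulVec_mulVec, Matrix.adjugate_mul, Matrix.smul_mulVec, Matrix.one_mulVec]
  have h2 : p ∣ A.det * pderiv ℂ j p := by
    have := congrFun h1 j
    rw [Pi.smul_apply, smul_eq_mul] at this
    rw [this]
    exact Finset.dvd_sum (s := Finset.univ) (f := fun i => A.adjugate j i * _)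
      fun i _ => (hA i).mul_left _
  exact (hp.dvd_or_dvd h2).resolve_right hj

/-- Saito's criterion: `n` logarithmic vector fields whose determinant is a unit times the reduced
series `f` generate the module of logarithmic vector fields. -/
theorem logModule_eq_span (hf : Squarefree f) {δ : Fin n → FormalDer n}
    (hδ : ∀ i, δ i ∈ logModule f) {u : (FormalRing n)ˣ}
    (hu : (Matrix.of fun i j => δ i (MvPowerSeries.X j)).det = (u : FormalRing n) * f) :
    logModule f = Submodule.span (FormalRing n) (Set.range δ) := by
  apply le_antisymm
  · intro η hη
    set A : Matrix (Fin n) (Fin n) (FormalRing n) := Matrix.of fun i j => δ i (MvPowerSeries.X j)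
    let b : Fin n → FormalRing n := fun j => η (MvPowerSeries.X j)
    -- The Cramer numerators are determinants with one row replaced by `η`, again a logarithmic
    -- field. They are thus divisible by `f`, so Cramer's rule has solutions in the ring.
    have hdvd : ∀ i, f ∣ A.transpose.cramer b i := by
      intro i
      rw [Matrix.cramer_transpose_apply]
      have h1 : A.updateRow i b =
          Matrix.of fun k j => (Function.update δ i η) k (MvPowerSeries.X j) := by
        ext1 k j
        by_cases h : k = i
        · subst h
          simp [b]
        · simp [A, h]
      rw [h1]
      refine dvd_det_of_mem_logModule hf fun k => ?_
      by_cases h : k = i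
      · subst h
        simpa using hη
      · simpa [h] using hδ k
    choose c hc using hdvd
    have h2 := Matrix.mulVec_cramer A.transpose b
    rw [Matrix.det_transpose, hu] at h2
    have h3 : η = ∑ i, ((↑u⁻¹ : FormalRing n) * c i) • δ i := by
      refine derivation_ext fun j => ?_
      have h4 := congrFun h2 j
      simp only [Matrix.mulVec, dotProduct, Matrix.transpose_apply, hc, Pi.smul_apply,
        smul_eq_mul] at h4
      have h5 : f * (∑ i, A i j * c i) = f * (u * b j) := by
        rw [Finset.mul_sum, ← mul_assoc, mul_comm f, ← h4]
        exact Finset.sum_congr rfl fun i _ => by ring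
      have h6 := mul_left_cancel₀ hf.ne_zero h5
      rw [derivation_sum_apply]
      simp only [Derivation.smul_apply, smul_eq_mul, mul_assoc]
      rw [← Finset.mul_sum]
      have h7 : ∑ i, c i * (δ i) (MvPowerSeries.X j) = u * b j := by
        rw [← h6]
        exact Finset.sum_congr rfl fun i _ => mul_comm _ _
      rw [h7, Units.inv_mul_cancel_left]
    rw [h3]
    exact Submodule.sum_mem _ fun i _ =>
      Submodule.smul_mem _ _ (Submodule.subset_span ⟨i, rfl⟩)
  · rw [Submodule.span_le]
    rintro _ ⟨i, rfl⟩
    exact hδ i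

end FormalDer

/-! ### An invariant tensor of a perfect three-dimensional Lie algebra -/

section PerfectLieAlgebra

open Module

variable {K L : Type*} [Field K] [LieRing L] [LieAlgebra K L]

/-- The brackets `⁅b₁, b₂⁆`, `⁅b₂, b₀⁆`, `⁅b₀, b₁⁆` of a triple of elements. -/
def cyclicBracket (b : Fin 3 → L) (i : Fin 3) : L := ⁅b (i + 1), b (i + 2)⁆

theorem cyclicBracket_zero (b : Fin 3 → L) : cyclicBracket b 0 = ⁅b 1, b 2⁆ := rfl
theorem cyclicBracket_one (b : Fin 3 → L) : cyclicBracket b 1 = ⁅b 2, b 0⁆ := rfl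
theorem cyclicBracket_two (b : Fin 3 → L) : cyclicBracket b 2 = ⁅b 0, b 1⁆ := rfl

theorem LieAlgebra.derivedSeries_one_le {S : Submodule K L} (h : ∀ x y : L, ⁅x, y⁆ ∈ S) :
    (derivedSeries K L 1).toSubmodule ≤ S := by
  rw [derivedSeries_def, derivedSeriesOfIdeal_succ, derivedSeriesOfIdeal_zero,
    LieSubmodule.lieIdeal_oper_eq_linear_span', Submodule.span_le]
  rintro _ ⟨x, -, y, -, rfl⟩
  exact h x y

/-- A subspace of a perfect Lie algebra that contains all brackets is everything. -/
theorem LieAlgebra.mem_of_forall_lie_mem (hL : derivedSeries K L 1 = ⊤) {S : Submodule K L}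
    (h : ∀ x y : L, ⁅x, y⁆ ∈ S) (x : L) : x ∈ S := by
  have h1 := derivedSeries_one_le h
  rw [hL] at h1
  exact h1 (LieSubmodule.mem_top x)

theorem span_cyclicBracket (b : Basis (Fin 3) K L)
    (hL : LieAlgebra.derivedSeries K L 1 = ⊤) :
    Submodule.span K (Set.range (cyclicBracket b)) = ⊤ := by
  set S := Submodule.span K (Set.range (cyclicBracket b)) with hS
  have hmem : ∀ i, cyclicBracket b i ∈ S := fun i => Submodule.subset_span ⟨i, rfl⟩
  have hb : ∀ i j, ⁅b i, b j⁆ ∈ S := by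
    have h0 := hmem 0
    have h1 := hmem 1
    have h2 := hmem 2
    rw [cyclicBracket_zero] at h0
    rw [cyclicBracket_one] at h1
    rw [cyclicBracket_two] at h2
    have h0' := S.neg_mem h0
    have h1' := S.neg_mem h1
    have h2' := S.neg_mem h2
    rw [lie_skew] at h0' h1' h2'
    intro i j
    fin_cases i <;> fin_cases j <;> simp <;> assumption
  have hxy : ∀ x y : L, ⁅x, y⁆ ∈ S := by
    intro x y
    rw [← b.sum_repr x, ← b.sum_repr y, sum_lie]
    refine Submodule.sum_mem _ fun i _ => ?_
    rw [lie_sum]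
    refine Submodule.sum_mem _ fun j _ => ?_
    rw [smul_lie, lie_smul]
    exact S.smul_mem _ (S.smul_mem _ (hb i j))
  exact eq_top_iff.mpr fun x _ => LieAlgebra.mem_of_forall_lie_mem hL hxy x

/-- The tensor `∑ bᵢ ⊗ wᵢ`, with `w` the cyclic brackets of a basis `b` of a perfect
three-dimensional Lie algebra, is invariant. -/
theorem cyclicBracket_invariant (b : Basis (Fin 3) K L)
    (hL : LieAlgebra.derivedSeries K L 1 = ⊤) {X : Type*} [AddCommGroup X] [Module K X]
    (B : L →ₗ[K] L →ₗ[K] X) (x : L) :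
    ∑ i, (B ⁅x, b i⁆ (cyclicBracket b i) + B (b i) ⁅x, cyclicBracket b i⁆) = 0 := by
  have hli : LinearIndependent K (cyclicBracket b) :=
    linearIndependent_of_top_le_span_of_card_eq_finrank (span_cyclicBracket b hL).ge
      (by rw [finrank_eq_card_basis b])
  have hw : ∀ i, cyclicBracket b i = ∑ j, b.repr (cyclicBracket b i) j • b j :=
    fun i => (b.sum_repr _).symm
  set M : Fin 3 → Fin 3 → K := fun i j => b.repr (cyclicBracket b i) j with hM
  have hw0 : ⁅b 1, b 2⁆ = M 0 0 • b 0 + M 0 1 • b 1 + M 0 2 • b 2 := by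
    rw [← cyclicBracket_zero, hw, Fin.sum_univ_three]
  have hw1 : ⁅b 2, b 0⁆ = M 1 0 • b 0 + M 1 1 • b 1 + M 1 2 • b 2 := by
    rw [← cyclicBracket_one, hw, Fin.sum_univ_three]
  have hw2 : ⁅b 0, b 1⁆ = M 2 0 • b 0 + M 2 1 • b 1 + M 2 2 • b 2 := by
    rw [← cyclicBracket_two, hw, Fin.sum_univ_three]
  have hs0 : ⁅b 2, b 1⁆ = -⁅b 1, b 2⁆ := (lie_skew _ _).symm
  have hs1 : ⁅b 0, b 2⁆ = -⁅b 2, b 0⁆ := (lie_skew _ _).symm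
  have hs2 : ⁅b 1, b 0⁆ = -⁅b 0, b 1⁆ := (lie_skew _ _).symm
  -- The Jacobi identity is a linear relation among the cyclic brackets, with the antisymmetric part
  -- of `M` as coefficients. Independence then makes `M` symmetric, and this symmetry is what
  -- cancels the terms for x = bⱼ.
  have hjac : (M 1 2 - M 2 1) • ⁅b 1, b 2⁆ + (M 2 0 - M 0 2) • ⁅b 2, b 0⁆ +
      (M 0 1 - M 1 0) • ⁅b 0, b 1⁆ = 0 := by
    have h := lie_jacobi (b 0) (b 1) (b 2)
    rw [hw0, hw1, hw2] at h
    simp only [lie_add, lie_smul, lie_self, smul_zero, hs0, hs1, hs2] at h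
    rw [← h]
    module
  have hsym : M 1 2 = M 2 1 ∧ M 2 0 = M 0 2 ∧ M 0 1 = M 1 0 := by
    have h := Fintype.linearIndependent_iff.mp hli ![M 1 2 - M 2 1, M 2 0 - M 0 2, M 0 1 - M 1 0]
      (by simpa [Fin.sum_univ_three, cyclicBracket_zero, cyclicBracket_one, cyclicBracket_two]
        using hjac)
    exact ⟨sub_eq_zero.mp (h 0), sub_eq_zero.mp (h 1), sub_eq_zero.mp (h 2)⟩
  obtain ⟨hs12, hs20, hs01⟩ := hsym
  induction b.mem_span x using Submodule.span_induction with
  | mem x hx =>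
    obtain ⟨j, rfl⟩ := hx
    have e0 : cyclicBracket b 0 = ⁅b 1, b 2⁆ := rfl
    have e1 : cyclicBracket b 1 = ⁅b 2, b 0⁆ := rfl
    have e2 : cyclicBracket b 2 = ⁅b 0, b 1⁆ := rfl
    rw [Fin.sum_univ_three, e0, e1, e2]
    have k0 : ∀ z : L, ⁅z, ⁅b 1, b 2⁆⁆ = M 0 0 • ⁅z, b 0⁆ + M 0 1 • ⁅z, b 1⁆ + M 0 2 • ⁅z, b 2⁆ :=
      fun z : L => by conv_lhs => rw [hw0, lie_add, lie_add, lie_smul, lie_smul, lie_smul]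
    have k1 : ∀ z : L, ⁅z, ⁅b 2, b 0⁆⁆ = M 1 0 • ⁅z, b 0⁆ + M 1 1 • ⁅z, b 1⁆ + M 1 2 • ⁅z, b 2⁆ :=
      fun z : L => by conv_lhs => rw [hw1, lie_add, lie_add, lie_smul, lie_smul, lie_smul]
    have k2 : ∀ z : L, ⁅z, ⁅b 0, b 1⁆⁆ = M 2 0 • ⁅z, b 0⁆ + M 2 1 • ⁅z, b 1⁆ + M 2 2 • ⁅z, b 2⁆ :=
      fun z : L => by conv_lhs => rw [hw2, lie_add, lie_add, lie_smul, lie_smul, lie_smul]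
    rw [k0, k1, k2]
    have f0 : ∀ y, B ⁅b 1, b 2⁆ y = M 0 0 • B (b 0) y + M 0 1 • B (b 1) y + M 0 2 • B (b 2) y :=
      fun y => by conv_lhs => rw [hw0]; simp
    have f1 : ∀ y, B ⁅b 2, b 0⁆ y = M 1 0 • B (b 0) y + M 1 1 • B (b 1) y + M 1 2 • B (b 2) y :=
      fun y => by conv_lhs => rw [hw1]; simp
    have f2 : ∀ y, B ⁅b 0, b 1⁆ y = M 2 0 • B (b 0) y + M 2 1 • B (b 1) y + M 2 2 • B (b 2) y :=
      fun y => by conv_lhs => rw [hw2]; simp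
    fin_cases j <;>
    · simp only [Fin.zero_eta, Fin.mk_one, Fin.reduceFinMk, lie_self, hs0, hs1, hs2, smul_zero,
        map_zero, LinearMap.zero_apply, map_add, map_smul, map_neg, LinearMap.neg_apply, smul_neg,
        f0, f1, f2, hs12, hs20, hs01]
      module
  | zero => simp
  | add x y _ _ hx hy =>
    rw [← add_zero (0 : X)]
    nth_rw 1 [← hx]
    rw [← hy, ← Finset.sum_add_distrib]
    refine Finset.sum_congr rfl fun i _ => ?_
    simp only [add_lie, map_add, LinearMap.add_apply]
    abel
  | smul c x _ hx =>
    rw [← smul_zero c, ← hx, Finset.smul_sum]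
    refine Finset.sum_congr rfl fun i _ => ?_
    simp only [smul_lie, map_smul, LinearMap.smul_apply, smul_add]

end PerfectLieAlgebra

/-! ### The Casimir operator and the first Whitehead lemma -/

section PerfectLieAlgebra

open Module

variable {K L : Type*} [Field K] [LieRing L] [LieAlgebra K L]

section Module

variable (V : Type*) [AddCommGroup V] [Module K V] [LieRingModule L V] [LieModule K L V]

/-- The action of `∑ bᵢ wᵢ` on a module, with `w` the cyclic brackets of `b`. For a basis `b` of a
perfect three-dimensional Lie algebra, this is a Casimir operator. -/
def cyclicCasimir (b : Fin 3 → L) : Module.End K V :=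
  ∑ i, LieModule.toEnd K L V (b i) * LieModule.toEnd K L V (cyclicBracket b i)

variable {V}

theorem cyclicCasimir_apply (b : Fin 3 → L) (v : V) :
    cyclicCasimir (K := K) V b v = ∑ i, ⁅b i, ⁅cyclicBracket b i, v⁆⁆ := by
  simp [cyclicCasimir, LinearMap.sum_apply]

theorem cyclicCasimir_lie (b : Basis (Fin 3) K L) (hL : LieAlgebra.derivedSeries K L 1 = ⊤)
    (x : L) (v : V) :
    cyclicCasimir (K := K) V b ⁅x, v⁆ = ⁅x, cyclicCasimir (K := K) V b v⁆ := by
  let B : L →ₗ[K] L →ₗ[K] V :=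
    LinearMap.mk₂ K (fun y z => ⁅y, ⁅z, v⁆⁆) (by simp) (by simp) (by simp) (by simp)
  have h := cyclicBracket_invariant b hL B x
  simp only [B, LinearMap.mk₂_apply] at h
  rw [cyclicCasimir_apply, cyclicCasimir_apply, lie_sum, eq_comm, ← sub_eq_zero, ← h,
    ← Finset.sum_sub_distrib]
  refine Finset.sum_congr rfl fun i _ => ?_
  rw [leibniz_lie x (b i), leibniz_lie x (cyclicBracket b i), lie_add]
  abel

/-- A nilpotent representation of a perfect Lie algebra is trivial. -/
theorem LieModule.lie_eq_zero_of_isNilpotent_of_perfect [LieModule.IsNilpotent L V]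
    (hL : LieAlgebra.derivedSeries K L 1 = ⊤) (x : L) (v : V) : ⁅x, v⁆ = 0 := by
  -- For x = ⁅y, z⁆ the action is ⁅y, ⁅z, v⁆⁆ − ⁅z, ⁅y, v⁆⁆, one step deeper in the lower central
  -- series. By perfectness such `x` span.
  have key : ∀ k, ∀ (x : L) (v : V), ⁅x, v⁆ ∈ LieModule.lowerCentralSeries K L V k := by
    intro k
    induction k with
    | zero => simp
    | succ k ih =>
      intro x v
      let S : Submodule K L := (LieModule.lowerCentralSeries K L V (k + 1)).toSubmodule.comap
        ((LieModule.toEnd K L V : L →ₗ[K] Module.End K V).flip v)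
      have hS : ∀ z, z ∈ S ↔ ⁅z, v⁆ ∈ LieModule.lowerCentralSeries K L V (k + 1) :=
        fun _ => Iff.rfl
      refine (hS x).mp (LieAlgebra.mem_of_forall_lie_mem hL (fun y z => ?_) x)
      rw [hS, lie_lie, LieModule.lowerCentralSeries_succ]
      exact sub_mem (LieSubmodule.lie_mem_lie (LieSubmodule.mem_top y) (ih z v))
        (LieSubmodule.lie_mem_lie (LieSubmodule.mem_top z) (ih y v))
  obtain ⟨k, hk⟩ := (LieModule.isNilpotent_iff K L V).mp inferInstance
  simpa [hk] using key k x v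

/-- If the Casimir operator of a perfect three-dimensional Lie algebra acts nilpotently, then the
representation is trivial. -/
theorem lie_eq_zero_of_isNilpotent_cyclicCasimir [CharZero K] [FiniteDimensional K V]
    (b : Basis (Fin 3) K L) (hL : LieAlgebra.derivedSeries K L 1 = ⊤)
    (hC : IsNilpotent (cyclicCasimir (K := K) V b)) (x : L) (v : V) : ⁅x, v⁆ = 0 := by
  set κ := LieModule.traceForm K L V with hκ
  -- The trace of the Casimir operator is 3κ(b₀, ⁅b₁, b₂⁆) by invariance of κ. Its vanishing kills κ
  -- on all pairs bᵢ, wⱼ, hence everywhere.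
  have htr : ∑ i, κ (b i) (cyclicBracket b i) = 0 := by
    have h := (LinearMap.isNilpotent_trace_of_isNilpotent hC).eq_zero
    rw [cyclicCasimir, map_sum] at h
    exact h
  have hinv : ∀ x y z, κ ⁅x, y⁆ z = κ x ⁅y, z⁆ := LieModule.traceForm_apply_lie_apply K L V
  have hsymm : ∀ x y, κ x y = κ y x := LieModule.traceForm_comm K L V
  have halt : ∀ x y, κ x ⁅x, y⁆ = 0 := fun x y => by rw [← hinv, lie_self]; simp
  have halt' : ∀ x y, κ x ⁅y, x⁆ = 0 := fun x y => by
    rw [← lie_skew, map_neg, halt, neg_zero]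
  have h1 : κ (b 1) ⁅b 2, b 0⁆ = κ (b 0) ⁅b 1, b 2⁆ := by rw [← hinv, hsymm]
  have h2 : κ (b 2) ⁅b 0, b 1⁆ = κ (b 0) ⁅b 1, b 2⁆ := by rw [hsymm, hinv]
  have h0 : κ (b 0) ⁅b 1, b 2⁆ = 0 := by
    rw [Fin.sum_univ_three, cyclicBracket_zero, cyclicBracket_one, cyclicBracket_two, h1, h2,
      ← two_mul, ← add_one_mul] at htr
    exact (mul_eq_zero.mp htr).resolve_left (by norm_num)
  have hbw : ∀ i j, κ (b i) (cyclicBracket b j) = 0 := by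
    intro i j
    fin_cases i <;> fin_cases j <;>
      simp [cyclicBracket_zero, cyclicBracket_one, cyclicBracket_two, h0, h1, h2, halt, halt']
  have hκ0 : κ = 0 := by
    refine b.ext fun i => LinearMap.ext_on (span_cyclicBracket b hL) ?_
    rintro _ ⟨j, rfl⟩
    simpa using hbw i j
  -- A vanishing trace form makes the derived algebra act nilpotently, and here the derived algebra
  -- is all of `L`.
  have hnil := LieModule.isNilpotent_derivedSeries_of_traceForm_eq_zero hκ0
  rw [LieModule.isNilpotent_iff_forall' (R := K)] at hnil
  have : LieModule.IsNilpotent L V := by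
    rw [LieModule.isNilpotent_iff_forall' (R := K)]
    have := b.finiteDimensional_of_finite
    intro y
    exact hnil ⟨y, by rw [hL]; exact LieSubmodule.mem_top y⟩
  exact LieModule.lie_eq_zero_of_isNilpotent_of_perfect hL x v

/-- The generalized kernel of the Casimir operator. -/
noncomputable def cyclicCasimirKer (b : Basis (Fin 3) K L)
    (hL : LieAlgebra.derivedSeries K L 1 = ⊤) (k : ℕ) :
    LieSubmodule K L V where
  __ := LinearMap.ker (cyclicCasimir (K := K) V b ^ k)
  lie_mem {x v} hv := by
    have hcomm : Commute (LieModule.toEnd K L V x) (cyclicCasimir (K := K) V b) :=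
      LinearMap.ext fun w => (cyclicCasimir_lie b hL x w).symm
    have h := LinearMap.congr_fun (hcomm.pow_right k).eq v
    have hv' : (cyclicCasimir (K := K) V b ^ k) v = 0 := hv
    change (cyclicCasimir (K := K) V b ^ k) ⁅x, v⁆ = 0
    simp only [Module.End.mul_apply, LieModule.toEnd_apply_apply, hv', lie_zero] at h
    exact h.symm

/-- The generalized kernel is a subrepresentation on which the Casimir operator is nilpotent. -/
theorem lie_eq_zero_of_cyclicCasimir_pow_eq_zero [CharZero K] [FiniteDimensional K V]
    (b : Basis (Fin 3) K L) (hL : LieAlgebra.derivedSeries K L 1 = ⊤) {k : ℕ} {v : V}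
    (hv : (cyclicCasimir (K := K) V b ^ k) v = 0) (x : L) : ⁅x, v⁆ = 0 := by
  let N : LieSubmodule K L V := cyclicCasimirKer b hL k
  have hcoe : ∀ (m : ℕ) (w : N), (((cyclicCasimir (K := K) N b ^ m) w : N) : V) =
      (cyclicCasimir (K := K) V b ^ m) w := by
    intro m
    induction m with
    | zero => simp
    | succ m ih =>
      intro w
      rw [pow_succ, pow_succ, Module.End.mul_apply, Module.End.mul_apply, ih,
        cyclicCasimir_apply, cyclicCasimir_apply]
      simp
  have hnil : IsNilpotent (cyclicCasimir (K := K) N b) :=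
    ⟨k, LinearMap.ext fun w => Subtype.ext (by rw [hcoe]; exact w.2)⟩
  have h := lie_eq_zero_of_isNilpotent_cyclicCasimir b hL hnil x ⟨v, hv⟩
  simpa using congrArg Subtype.val h

/-- The first Whitehead lemma for perfect three-dimensional Lie algebras. -/
theorem exists_eq_lie_of_cocycle [CharZero K] [FiniteDimensional K V]
    (b : Basis (Fin 3) K L) (hL : LieAlgebra.derivedSeries K L 1 = ⊤) (φ : L →ₗ[K] V)
    (hφ : ∀ x y, φ ⁅x, y⁆ = ⁅x, φ y⁆ - ⁅y, φ x⁆) : ∃ v, ∀ x, φ x = ⁅x, v⁆ := by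
  set C := cyclicCasimir (K := K) V b with hC
  have hCx : ∀ x v, C ⁅x, v⁆ = ⁅x, C v⁆ := cyclicCasimir_lie b hL
  have htriv : ∀ (k : ℕ) (v : V), (C ^ k) v = 0 → ∀ x : L, ⁅x, v⁆ = 0 :=
    fun k v hv x => lie_eq_zero_of_cyclicCasimir_pow_eq_zero b hL hv x
  -- If C²w = 0, then `L` acts trivially on `w`, so already Cw = 0.
  have hker : LinearMap.ker C ⊓ LinearMap.range C = ⊥ := by
    rw [eq_bot_iff]
    rintro v ⟨h1, w, rfl⟩
    have h2 : (C ^ 2) w = 0 := by rw [pow_two]; exact h1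
    rw [Submodule.mem_bot, hC, cyclicCasimir_apply]
    exact Finset.sum_eq_zero fun i _ => by rw [htriv 2 w h2, lie_zero]
  have hcompl : LinearMap.ker C ⊔ LinearMap.range C = ⊤ := by
    apply Submodule.eq_top_of_finrank_eq
    have h1 := Submodule.finrank_sup_add_finrank_inf_eq (LinearMap.ker C) (LinearMap.range C)
    have h2 := LinearMap.finrank_range_add_finrank_ker C
    rw [hker, finrank_bot] at h1
    omega
  have hdecomp : ∀ v : V, ∃ k u, (∀ x : L, ⁅x, k⁆ = 0) ∧ v = k + C u := by
    intro v
    obtain ⟨k, hk, _, ⟨u, rfl⟩, rfl⟩ := Submodule.mem_sup.mp (hcompl ▸ Submodule.mem_top (x := v))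
    exact ⟨k, u, htriv 1 k (by simpa using hk), rfl⟩
  have hlie : ∀ (x : L) (v : V), ⁅x, v⁆ ∈ LinearMap.range C := by
    intro x v
    obtain ⟨k, u, hk, rfl⟩ := hdecomp v
    exact ⟨⁅x, u⁆, by rw [lie_add, hk, zero_add, hCx]⟩
  have hrange : ∀ x, φ x ∈ LinearMap.range C := by
    intro x
    refine LieAlgebra.mem_of_forall_lie_mem (S := (LinearMap.range C).comap φ) hL
      (fun y z => ?_) x
    rw [Submodule.mem_comap, hφ]
    exact sub_mem (hlie _ _) (hlie _ _)
  -- Invariance of the tensor, applied to (y, z) ↦ ⁅y, φ z⁆, shows that C ∘ φ is a coboundary.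
  have hv₀ : ∀ x, C (φ x) = ⁅x, ∑ i, ⁅b i, φ (cyclicBracket b i)⁆⁆ := by
    intro x
    let B : L →ₗ[K] L →ₗ[K] V :=
      LinearMap.mk₂ K (fun y z => ⁅y, φ z⁆) (by simp) (by simp) (by simp) (by simp)
    have h := cyclicBracket_invariant b hL B x
    simp only [B, LinearMap.mk₂_apply, hφ, lie_sub] at h
    rw [hC, cyclicCasimir_apply, lie_sum, eq_comm, ← sub_eq_zero, ← h, ← Finset.sum_sub_distrib]
    refine Finset.sum_congr rfl fun i _ => ?_
    rw [leibniz_lie x (b i)]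
    abel
  -- Dividing by `C` up to an invariant vector gives `u`. The difference φ x − ⁅x, u⁆ then lies in
  -- ker C ∩ range C = 0.
  obtain ⟨k, u, hk, hku⟩ := hdecomp (∑ i, ⁅b i, φ (cyclicBracket b i)⁆)
  refine ⟨u, fun x => ?_⟩
  rw [← sub_eq_zero, ← Submodule.mem_bot K, ← hker]
  refine ⟨?_, sub_mem (hrange x) (hlie x u)⟩
  rw [SetLike.mem_coe, LinearMap.mem_ker, map_sub, hv₀, hku, lie_add, hk, zero_add, hCx, sub_self]

end Module

attribute [local instance] LieRing.ofAssociativeRing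

theorem LieHom.exists_eq_apply_of_cocycle [CharZero K] {V : Type*} [AddCommGroup V] [Module K V]
    [FiniteDimensional K V] (ρ : L →ₗ⁅K⁆ Module.End K V)
    (b : Basis (Fin 3) K L) (hL : LieAlgebra.derivedSeries K L 1 = ⊤) (φ : L →ₗ[K] V)
    (hφ : ∀ x y, φ ⁅x, y⁆ = ρ x (φ y) - ρ y (φ x)) : ∃ v, ∀ x, φ x = ρ x v := by
  let _ : LieRingModule L V := LieRingModule.compLieHom V ρ
  have _ : LieModule K L V := LieModule.compLieHom V ρ
  exact exists_eq_lie_of_cocycle b hL φ hφ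

/-- The first Whitehead lemma for a Lie algebra `D` with a perfect three-dimensional quotient `D/I`
and a finite-dimensional subquotient `N/N'` of a representation of `D`, on which `I` acts
trivially. -/
theorem exists_sub_lie_mem_of_cocycle [CharZero K] {D M : Type*} [LieRing D] [LieAlgebra K D]
    [AddCommGroup M] [Module K M] [LieRingModule D M] [LieModule K D M] (I : LieIdeal K D)
    (b : Basis (Fin 3) K (D ⧸ I)) (hI : LieAlgebra.derivedSeries K (D ⧸ I) 1 = ⊤)
    (N N' : LieSubmodule K D M)
    [FiniteDimensional K (N ⧸ N'.comap N.incl)]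
    (hIN : ∀ x ∈ I, ∀ v ∈ N, ⁅x, v⁆ ∈ N') (φ : D →ₗ[K] M) (hφN : ∀ x, φ x ∈ N)
    (hφI : ∀ x ∈ I, φ x ∈ N') (hφ : ∀ x y, φ ⁅x, y⁆ = ⁅x, φ y⁆ - ⁅y, φ x⁆) :
    ∃ v ∈ N, ∀ x, φ x - ⁅x, v⁆ ∈ N' := by
  let Q := N ⧸ N'.comap N.incl
  let ρ₀ : D →ₗ⁅K⁆ Module.End K Q := LieModule.toEnd K D Q
  have hρ₀ : I.toSubmodule ≤ LinearMap.ker (ρ₀ : D →ₗ[K] Module.End K Q) := by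
    intro x hx
    refine LinearMap.ext fun q => ?_
    obtain ⟨v, rfl⟩ := LieSubmodule.Quotient.surjective_mk' _ q
    change ⁅x, LieSubmodule.Quotient.mk' (N'.comap N.incl) v⁆ = 0
    rw [← LieModuleHom.map_lie, LieSubmodule.Quotient.mk_eq_zero]
    exact hIN x hx v v.2
  let ρ : (D ⧸ I) →ₗ⁅K⁆ Module.End K Q :=
    { I.toSubmodule.liftQ (ρ₀ : D →ₗ[K] Module.End K Q) hρ₀ with
      map_lie' := by
        intro x y
        obtain ⟨x, rfl⟩ := LieSubmodule.Quotient.surjective_mk' _ x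
        obtain ⟨y, rfl⟩ := LieSubmodule.Quotient.surjective_mk' _ y
        exact ρ₀.map_lie x y }
  let φ₀ : D →ₗ[K] Q := (N'.comap N.incl).toSubmodule.mkQ ∘ₗ φ.codRestrict N.toSubmodule hφN
  let φ' : (D ⧸ I) →ₗ[K] Q := I.toSubmodule.liftQ φ₀ (fun x hx => by
    rw [LinearMap.mem_ker]
    exact (Submodule.Quotient.mk_eq_zero _).mpr (hφI x hx))
  obtain ⟨q, hq⟩ := LieHom.exists_eq_apply_of_cocycle ρ b hI φ' (by
    intro x y
    obtain ⟨x, rfl⟩ := LieSubmodule.Quotient.surjective_mk' _ x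
    obtain ⟨y, rfl⟩ := LieSubmodule.Quotient.surjective_mk' _ y
    change φ₀ ⁅x, y⁆ = ⁅x, φ₀ y⁆ - ⁅y, φ₀ x⁆
    have h : φ.codRestrict N.toSubmodule hφN ⁅x, y⁆ =
      (⁅x, (⟨φ y, hφN y⟩ : N)⁆ - ⁅y, (⟨φ x, hφN x⟩ : N)⁆ : N) := Subtype.ext (hφ x y)
    change LieSubmodule.Quotient.mk' (N'.comap N.incl) _ = _
    rw [h, map_sub, LieModuleHom.map_lie, LieModuleHom.map_lie]
    rfl)
  obtain ⟨v, rfl⟩ := LieSubmodule.Quotient.surjective_mk' _ q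
  refine ⟨v, v.2, fun x => ?_⟩
  have h := hq (LieSubmodule.Quotient.mk' I x)
  change LieSubmodule.Quotient.mk' (N'.comap N.incl) (⟨φ x, hφN x⟩ : N) =
    ⁅x, LieSubmodule.Quotient.mk' (N'.comap N.incl) v⁆ at h
  rw [← LieModuleHom.map_lie, ← sub_eq_zero, ← map_sub, LieSubmodule.Quotient.mk_eq_zero] at h
  exact h

end PerfectLieAlgebra

/-! ### Solvability in dimension at most three -/

namespace LieAlgebra

open Module

variable {K L : Type*} [Field K] [LieRing L] [LieAlgebra K L]

theorem isSolvable_of_isSolvable_derivedSeries_one (h : IsSolvable (derivedSeries K L 1)) :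
    IsSolvable L := by
  obtain ⟨k, hk⟩ := (isSolvable_iff K _).mp h
  rw [LieIdeal.derivedSeries_eq_bot_iff, derivedSeries_def, ← derivedSeriesOfIdeal_add] at hk
  exact IsSolvable.mk (R := K) (k := k + 1) hk

theorem isSolvable_of_finrank_le_one [FiniteDimensional K L] (h : finrank K L ≤ 1) :
    IsSolvable L := by
  obtain ⟨v, hv⟩ := finrank_le_one_iff.mp h
  have : IsLieAbelian L := ⟨fun x y => by
    obtain ⟨c, rfl⟩ := hv x
    obtain ⟨d, rfl⟩ := hv y
    simp⟩
  infer_instance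

theorem isSolvable_of_finrank_le_two [FiniteDimensional K L] (h : finrank K L ≤ 2) :
    IsSolvable L := by
  rcases Nat.lt_or_eq_of_le h with h | h
  · exact isSolvable_of_finrank_le_one (K := K) (by omega)
  · let b := finBasisOfFinrankEq K L h
    have hle : (derivedSeries K L 1).toSubmodule ≤ Submodule.span K {⁅b 0, b 1⁆} := by
      refine derivedSeries_one_le fun x y => ?_
      rw [← b.sum_repr x, ← b.sum_repr y, Fin.sum_univ_two, Fin.sum_univ_two,
        Submodule.mem_span_singleton]
      refine ⟨b.repr x 0 * b.repr y 1 - b.repr x 1 * b.repr y 0, ?_⟩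
      have hs : ⁅b 1, b 0⁆ = -⁅b 0, b 1⁆ := (lie_skew _ _).symm
      simp only [lie_add, add_lie, lie_smul, smul_lie, lie_self, hs]
      module
    have h1 : finrank K (derivedSeries K L 1) ≤ 1 :=
      (Submodule.finrank_mono hle).trans ((finrank_span_le_card _).trans (by simp))
    exact isSolvable_of_isSolvable_derivedSeries_one (K := K)
      (isSolvable_of_finrank_le_one (K := K) h1)

/-- A Lie algebra of dimension at most three that is not solvable is perfect of dimension three. -/
theorem finrank_eq_three_of_not_isSolvable [FiniteDimensional K L] (h : finrank K L ≤ 3)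
    (hs : ¬ IsSolvable L) : finrank K L = 3 ∧ derivedSeries K L 1 = ⊤ := by
  have h3 : finrank K L = 3 := by
    by_contra hne
    exact hs (isSolvable_of_finrank_le_two (K := K) (by omega))
  refine ⟨h3, ?_⟩
  by_contra hne
  have hlt : finrank K (derivedSeries K L 1).toSubmodule < finrank K L :=
    Submodule.finrank_lt fun htop => hne ((LieSubmodule.toSubmodule_eq_top _).mp htop)
  exact hs (isSolvable_of_isSolvable_derivedSeries_one (K := K)
    (isSolvable_of_finrank_le_two (K := K) (by rw [h3] at hlt; exact Nat.lt_succ_iff.mp hlt)))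

end LieAlgebra

/-! ### The 𝔪-adic filtration and generators of Der_f -/

namespace FormalDer

open MvPowerSeries Module

variable {n : ℕ} {f : FormalRing n}

section Action

theorem lie_apply (x : logDer f) (g : FormalRing n) : ⁅x, g⁆ = (x : FormalDer n) g := rfl

theorem apply_mem_maxIdeal (hf : ¬ IsProduct f) {δ : FormalDer n} (hδ : δ ∈ logModule f)
    (g : FormalRing n) : δ g ∈ maxIdeal n :=
  apply_mem_of_mem_smul_top (not_not.mp hf hδ) g

/-- Logarithmic fields preserve 𝔪^d, and the coefficient in 𝔪 gains one order. Thus 𝔪·Der_f acts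
trivially on 𝔪^d/𝔪^(d+1). -/
theorem apply_mem_pow_succ (hf : ¬ IsProduct f) {δ : FormalDer n}
    (hδ : δ ∈ maxIdeal n • logModule f) {d : ℕ} {r : FormalRing n} (hr : r ∈ maxIdeal n ^ d) :
    δ r ∈ maxIdeal n ^ (d + 1) := by
  induction hδ using Submodule.smul_induction_on' with
  | smul s hs σ hσ =>
    rw [Derivation.smul_apply, smul_eq_mul, pow_succ']
    exact Ideal.mul_mem_mul hs (apply_mem_pow (apply_mem_maxIdeal hf hσ) d r hr)
  | add a _ b _ ha hb => exact Ideal.add_mem _ ha hb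

theorem lie_mem_pow_succ_smul (hf : ¬ IsProduct f) (d : ℕ) {δ η : FormalDer n}
    (hδ : δ ∈ maxIdeal n • logModule f) (hη : η ∈ maxIdeal n ^ d • logModule f) :
    ⁅δ, η⁆ ∈ maxIdeal n ^ (d + 1) • logModule f := by
  induction hη using Submodule.smul_induction_on' with
  | smul r hr ξ hξ =>
    have h2 : ⁅δ, r • ξ⁆ = δ r • ξ + r • ⁅δ, ξ⁆ := by
      refine Derivation.ext fun g => ?_
      simp only [Derivation.commutator_apply, Derivation.add_apply, Derivation.smul_apply,
        Derivation.leibniz, smul_eq_mul]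
      ring
    have h3 : ⁅δ, ξ⁆ ∈ maxIdeal n • logModule f := by
      have h : ⁅ξ, δ⁆ ∈ maxIdeal n ^ 1 • logModule f :=
        lie_mem_pow_smul hf 1 hξ (by rwa [pow_one])
      rw [pow_one] at h
      rw [← lie_skew]
      exact Submodule.neg_mem _ h
    rw [h2]
    refine Submodule.add_mem _ (Submodule.smul_mem_smul (apply_mem_pow_succ hf hδ hr) hξ) ?_
    rw [pow_succ, Submodule.mul_smul]
    exact Submodule.smul_mem_smul hr h3
  | add a _ b _ ha hb =>
    have h3 : ⁅δ, a + b⁆ = ⁅δ, a⁆ + ⁅δ, b⁆ := lie_add δ a b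
    rw [h3]
    exact Submodule.add_mem _ ha hb

theorem mem_truncIdeal {hf : ¬ IsProduct f} {d : ℕ} {x : logDer f} :
    x ∈ truncIdeal f hf d ↔ (x : FormalDer n) ∈ maxIdeal n ^ d • logModule f := Iff.rfl

/-- The powers of the maximal ideal as representations of the logarithmic vector fields. -/
def powSubmodule (hf : ¬ IsProduct f) (k : ℕ) : LieSubmodule ℂ (logDer f) (FormalRing n) where
  carrier := {g | g ∈ maxIdeal n ^ k}
  add_mem' := (maxIdeal n ^ k).add_mem
  zero_mem' := (maxIdeal n ^ k).zero_mem
  smul_mem' c _ hg := (maxIdeal n ^ k).smul_of_tower_mem c hg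
  lie_mem {x g} hg := apply_mem_pow (apply_mem_maxIdeal hf x.2) k g hg

instance finiteDimensional_powSubmodule_quotient (hf : ¬ IsProduct f) (k : ℕ) :
    FiniteDimensional ℂ (powSubmodule hf k ⧸
      (powSubmodule hf (k + 1)).comap (powSubmodule hf k).incl) := by
  have : Finite {d : Fin n →₀ ℕ | d.degree < k + 1} := 
    (Finsupp.finite_of_degree_lt (k + 1)).to_subtype
  -- The finitely many coefficients of degree at most `k` determine a class modulo 𝔪^(k+1).
  let φ : powSubmodule hf k →ₗ[ℂ] ({d : Fin n →₀ ℕ | d.degree < k + 1} → ℂ) :=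
    (LinearMap.pi fun d => MvPowerSeries.coeff d.1) ∘ₗ (powSubmodule hf k).toSubmodule.subtype
  have hφ : ((powSubmodule hf (k + 1)).comap (powSubmodule hf k).incl).toSubmodule =
      LinearMap.ker φ := by
    ext g
    rw [LinearMap.mem_ker, funext_iff]
    change (g : FormalRing n) ∈ maxIdeal n ^ (k + 1) ↔ _
    rw [mem_maximalIdeal_pow_iff]
    exact ⟨fun h d => h d.1 d.2, fun h d hd => h ⟨d, hd⟩⟩
  exact Module.Finite.of_injective
    (((powSubmodule hf (k + 1)).comap (powSubmodule hf k).incl).toSubmodule.liftQ φ hφ.le)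
    (LinearMap.ker_eq_bot.mp (Submodule.ker_liftQ_eq_bot' _ _ hφ))

end Action

section Generators

variable {δ : Fin n → FormalDer n}

/-- Modulo 𝔪·Der_f the power series coefficients of a combination of the `δᵢ` may be replaced by
their constant terms. -/
theorem span_range_mk_eq_top (hf : ¬ IsProduct f) (hδ : ∀ i, δ i ∈ logModule f)
    (hspan : logModule f = Submodule.span (FormalRing n) (Set.range δ)) :
    Submodule.span ℂ (Set.range fun i =>
      LieSubmodule.Quotient.mk' (truncIdeal f hf 1) (⟨δ i, hδ i⟩ : logDer f)) = ⊤ := by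
  rw [eq_top_iff]
  intro q _
  obtain ⟨x, rfl⟩ := LieSubmodule.Quotient.surjective_mk' _ q
  have hx : (x : FormalDer n) ∈ Submodule.span (FormalRing n) (Set.range δ) := hspan ▸ x.2
  obtain ⟨a, ha⟩ := (Submodule.mem_span_range_iff_exists_fun _).mp hx
  have h : LieSubmodule.Quotient.mk' (truncIdeal f hf 1) x =
      LieSubmodule.Quotient.mk' (truncIdeal f hf 1)
        (∑ i, constantCoeff (a i) • (⟨δ i, hδ i⟩ : logDer f)) := by
    rw [← sub_eq_zero, ← map_sub, LieSubmodule.Quotient.mk_eq_zero, mem_truncIdeal, pow_one]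
    have h1 : ((x - ∑ i, constantCoeff (a i) • (⟨δ i, hδ i⟩ : logDer f) : logDer f) : FormalDer n) =
        ∑ i, (a i - C (constantCoeff (a i)) : FormalRing n) • δ i := by
      rw [AddSubgroupClass.coe_sub, ← ha]
      have h2 : ((∑ i, constantCoeff (a i) • (⟨δ i, hδ i⟩ : logDer f) : logDer f) : FormalDer n) =
          ∑ i, (C (constantCoeff (a i)) : FormalRing n) • δ i := by
        rw [← LieSubalgebra.coe_incl, map_sum]
        refine Finset.sum_congr rfl fun i _ => ?_
        refine Derivation.ext fun g => ?_
        change constantCoeff (a i) • δ i g = C (constantCoeff (a i)) * δ i g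
        rw [smul_eq_C_mul]
      rw [h2, ← Finset.sum_sub_distrib]
      exact Finset.sum_congr rfl fun i _ => (sub_smul _ _ _).symm
    rw [h1]
    exact Submodule.sum_mem _ fun i _ =>
      Submodule.smul_mem_smul (mem_maximalIdeal_iff.mpr (by simp)) (hδ i)
  rw [h, map_sum]
  refine Submodule.sum_mem _ fun i _ => ?_
  rw [map_smul]
  exact Submodule.smul_mem _ _ (Submodule.subset_span ⟨i, rfl⟩)

theorem finiteDimensional_truncated_one (hf : ¬ IsProduct f) (hδ : ∀ i, δ i ∈ logModule f)
    (hspan : logModule f = Submodule.span (FormalRing n) (Set.range δ)) :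
    FiniteDimensional ℂ (Truncated f hf 1) :=
  Module.Finite.of_fg_top (by
    rw [← span_range_mk_eq_top hf hδ hspan]
    exact Submodule.fg_span (Set.finite_range _))

theorem finrank_truncated_one_le (hf : ¬ IsProduct f) (hδ : ∀ i, δ i ∈ logModule f)
    (hspan : logModule f = Submodule.span (FormalRing n) (Set.range δ)) :
    finrank ℂ (Truncated f hf 1) ≤ n := by
  have h := finrank_range_le_card (R := ℂ) fun i =>
    LieSubmodule.Quotient.mk' (truncIdeal f hf 1) (⟨δ i, hδ i⟩ : logDer f)
  rw [Set.finrank, span_range_mk_eq_top hf hδ hspan, finrank_top, Fintype.card_fin] at h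
  exact h

end Generators

/-! ### Reduction to d = 1 -/

section Solvable

/-- The projection to the truncated Lie algebra. -/
noncomputable def truncProj (f : FormalRing n) (hf : ¬ IsProduct f) (d : ℕ) :
    logDer f →ₗ⁅ℂ⁆ Truncated f hf d where
  __ := (truncIdeal f hf d).toSubmodule.mkQ
  map_lie' := rfl

theorem truncProj_surjective (hf : ¬ IsProduct f) (d : ℕ) :
    Function.Surjective (truncProj f hf d) :=
  Submodule.mkQ_surjective _

theorem truncProj_eq_zero {hf : ¬ IsProduct f} {d : ℕ} {x : logDer f} :
    truncProj f hf d x = 0 ↔ x ∈ truncIdeal f hf d :=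
  Submodule.Quotient.mk_eq_zero _

/-- Once the derived series lies in 𝔪·Der_f, each further step brackets with elements of 𝔪·Der_f and
gains a power of 𝔪. -/
theorem isSolvable_truncated_of_isSolvable_truncated_one (hf : ¬ IsProduct f)
    (h : LieAlgebra.IsSolvable (Truncated f hf 1)) (d : ℕ) :
    LieAlgebra.IsSolvable (Truncated f hf (d + 1)) := by
  obtain ⟨k, hk⟩ := (LieAlgebra.isSolvable_iff ℂ _).mp h
  have h0 : LieAlgebra.derivedSeries ℂ (logDer f) k ≤ truncIdeal f hf 1 := by
    intro x hx
    rw [← truncProj_eq_zero, ← LieSubmodule.mem_bot (R := ℂ) (L := Truncated f hf 1), ← hk]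
    exact LieIdeal.derivedSeries_map_le k (LieIdeal.mem_map hx)
  have h1 : ∀ t, LieAlgebra.derivedSeries ℂ (logDer f) (k + t) ≤ truncIdeal f hf (t + 1) := by
    intro t
    induction t with
    | zero => exact h0
    | succ t ih =>
      rw [← add_assoc, LieAlgebra.derivedSeries_def, LieAlgebra.derivedSeriesOfIdeal_succ,
        ← LieAlgebra.derivedSeries_def, LieSubmodule.lie_le_iff]
      intro x hx y hy
      have hx1 : x ∈ truncIdeal f hf 1 :=
        h0 (LieAlgebra.derivedSeriesOfIdeal_antitone _ (Nat.le_add_right k t) hx)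
      rw [mem_truncIdeal, pow_one] at hx1
      exact lie_mem_pow_succ_smul hf (t + 1) hx1 (ih hy)
  refine LieAlgebra.IsSolvable.mk (R := ℂ) (k := k + d) ?_
  rw [← LieIdeal.derivedSeries_map_eq (f := truncProj f hf (d + 1)) _
    (truncProj_surjective hf (d + 1)), LieIdeal.map_eq_bot_iff]
  intro x hx
  exact LieHom.mem_ker.mpr (truncProj_eq_zero.mpr (h1 d hx))

end Solvable

/-! ### Cofactors of logarithmic vector fields -/

section Semiinvariant

/-- If the Lie algebra `Der_f / 𝔪 Der_f` is perfect of dimension three, then `f` can be multiplied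
by a unit in such a way that the cofactors of all logarithmic vector fields have order at
least `k`. -/
theorem exists_associated_cofactor_mem_pow (h0 : f ≠ 0) (hf : ¬ IsProduct f)
    (b : Basis (Fin 3) ℂ (Truncated f hf 1))
    (hb : LieAlgebra.derivedSeries ℂ (Truncated f hf 1) 1 = ⊤) (k : ℕ) :
    ∃ F : FormalRing n, Associated f F ∧ ∃ χ : logDer f →ₗ[ℂ] FormalRing n,
      (∀ x : logDer f, (x : FormalDer n) F = χ x * F) ∧ ∀ x, χ x ∈ maxIdeal n ^ k := by
  induction k with
  | zero =>
    have h : ∀ x : logDer f, ∃ c, (x : FormalDer n) f = c * f := fun x => by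
      obtain ⟨c, hc⟩ := mem_logModule_iff.mp x.2
      exact ⟨c, by rw [hc, mul_comm]⟩
    -- Cofactors are unique because `f` is a nonzero element of a domain, hence the choice is
    -- linear.
    choose χ hχ using h
    refine ⟨f, Associated.refl f, { toFun := χ, map_add' := fun x y => ?_, map_smul' := fun c x => ?_ },
      hχ, by simp⟩
    · apply mul_right_cancel₀ h0
      rw [add_mul, ← hχ, ← hχ, ← hχ]
      rfl
    · apply mul_right_cancel₀ h0
      rw [smul_mul_assoc, ← hχ, RingHom.id_apply, ← hχ]
      rfl
  | succ k ih =>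
    obtain ⟨F, hF, χ, hχ, hχk⟩ := ih
    have hF0 : F ≠ 0 := hF.ne_zero_iff.mp h0
    have hcoc : ∀ x y : logDer f, χ ⁅x, y⁆ = ⁅x, χ y⁆ - ⁅y, χ x⁆ := by
      intro x y
      apply mul_right_cancel₀ hF0
      rw [← hχ, lie_apply, lie_apply, LieSubalgebra.coe_bracket, Derivation.commutator_apply, hχ, hχ,
        Derivation.leibniz, Derivation.leibniz, hχ, hχ]
      simp only [smul_eq_mul]
      ring
    have hlin : ∀ δ : FormalDer n, δ ∈ maxIdeal n • logModule f →
        ∃ c ∈ maxIdeal n ^ (k + 1), δ F = c * F := by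
      intro δ hδ
      induction hδ using Submodule.smul_induction_on' with
      | smul r hr σ hσ =>
        refine ⟨r * χ ⟨σ, hσ⟩, ?_, ?_⟩
        · rw [pow_succ']
          exact Ideal.mul_mem_mul hr (hχk _)
        · rw [Derivation.smul_apply, smul_eq_mul, mul_assoc, ← hχ]
      | add a _ b _ ha hb =>
        obtain ⟨c, hc, hca⟩ := ha
        obtain ⟨d, hd, hdb⟩ := hb
        exact ⟨c + d, Ideal.add_mem _ hc hd, by rw [Derivation.add_apply, hca, hdb, add_mul]⟩
    obtain ⟨v, hv, hvχ⟩ := exists_sub_lie_mem_of_cocycle (truncIdeal f hf 1) b hb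
      (powSubmodule hf k) (powSubmodule hf (k + 1))
      (fun x hx g hg => by
        rw [mem_truncIdeal, pow_one] at hx
        exact apply_mem_pow_succ hf hx hg)
      χ hχk
      (fun x hx => by
        rw [mem_truncIdeal, pow_one] at hx
        obtain ⟨c, hc, hcF⟩ := hlin x hx
        rw [hχ] at hcF
        rw [mul_right_cancel₀ hF0 hcF]
        exact hc)
      hcoc
    -- For `k = 0` the series `v` may have a constant term. Removing it does not affect x(v) and
    -- makes 1 − w a unit.
    set w : FormalRing n := v - C (constantCoeff v) with hw
    have hw1 : w ∈ maxIdeal n := mem_maximalIdeal_iff.mpr (by simp [hw])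
    have hxw : ∀ x : logDer f, (x : FormalDer n) w = (x : FormalDer n) v := fun x => by
      have hC : (x : FormalDer n) (C (constantCoeff v)) = 0 := Derivation.map_algebraMap _ _
      rw [hw, map_sub, hC, sub_zero]
    obtain ⟨u, hu⟩ : IsUnit (1 - w) := by
      rw [MvPowerSeries.isUnit_iff_constantCoeff, map_sub, mem_maximalIdeal_iff.mp hw1]
      simp
    let χ' : logDer f →ₗ[ℂ] FormalRing n :=
      χ - LinearMap.mulLeft ℂ (↑u⁻¹ : FormalRing n) ∘ₗ
        ((LieModule.toEnd ℂ (logDer f) (FormalRing n) : logDer f →ₗ[ℂ]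
          Module.End ℂ (FormalRing n)).flip v)
    have hχ' : ∀ x : logDer f, χ' x = χ x - ↑u⁻¹ * (x : FormalDer n) v := fun _ => rfl
    have huinv : (↑u⁻¹ : FormalRing n) * (1 - w) = 1 := by rw [← hu, Units.inv_mul]
    refine ⟨F * u, hF.trans (associated_mul_unit_right F u u.isUnit), χ', fun x => ?_, fun x => ?_⟩
    · rw [hχ', hu, Derivation.leibniz, hχ, map_sub, Derivation.map_one_eq_zero, hxw, smul_eq_mul,
        smul_eq_mul]
      linear_combination (F * (x : FormalDer n) v) * huinv
    -- Since u⁻¹ = 1 + u⁻¹w, replacing u⁻¹x(v) by x(v) costs only an error in 𝔪·𝔪^k.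
    · have h1 : χ' x = (χ x - (x : FormalDer n) v) - ↑u⁻¹ * (w * (x : FormalDer n) v) := by
        rw [hχ']
        linear_combination (-(x : FormalDer n) v) * huinv
      rw [h1]
      refine Ideal.sub_mem _ (hvχ x) (Ideal.mul_mem_left _ _ ?_)
      rw [pow_succ']
      exact Ideal.mul_mem_mul hw1 (apply_mem_pow (apply_mem_maxIdeal hf x.2) k v hv)

/-- If `f` were a unit, every derivation would be logarithmic, including a partial derivative, which
sends its variable to 1. -/
theorem mem_maxIdeal_of_not_isProduct (hn : 0 < n) (hf : ¬ IsProduct f) : f ∈ maxIdeal n := by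
  by_contra h
  have hu : IsUnit f := by
    by_contra hu
    exact h ((IsLocalRing.mem_maximalIdeal f).mpr hu)
  have h1 := apply_mem_maxIdeal hf (mem_logModule_iff.mpr hu.dvd) (X ⟨0, hn⟩)
    (δ := pderiv ℂ (⟨0, hn⟩ : Fin n))
  rw [pderiv_X_self] at h1
  exact (Ideal.ne_top_iff_one _).mp (IsLocalRing.maximalIdeal.isMaximal _).ne_top h1

/-- For a free `f` that is not a product, the cofactors of the logarithmic vector fields do not
have arbitrarily high order, whatever unit multiple of `f` is chosen. -/
theorem not_forall_exists_associated_cofactor_mem_pow (hn : 0 < n) (h0 : f ≠ 0)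
    (hf : ¬ IsProduct f) {δ : Fin n → FormalDer n} {u : (FormalRing n)ˣ}
    (hu : (Matrix.of fun i j => δ i (MvPowerSeries.X j)).det = (u : FormalRing n) * f) :
    ¬ ∀ k, ∃ F : FormalRing n, Associated f F ∧ ∃ χ : Fin n → FormalRing n,
      (∀ i, δ i F = χ i * F) ∧ ∀ i, χ i ∈ maxIdeal n ^ k := by
  intro h
  refine h0 (eq_zero_of_forall_mem_maximalIdeal_pow fun k => ?_)
  obtain ⟨F, ⟨v, hv⟩, χ, hχ, hχk⟩ := h k
  have hF0 : F ≠ 0 := by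
    rw [← hv]
    exact mul_ne_zero h0 v.ne_zero
  have hfF : f = F * ↑v⁻¹ := by rw [← hv, Units.mul_inv_cancel_right]
  set A : Matrix (Fin n) (Fin n) (FormalRing n) := Matrix.of fun i j => δ i (MvPowerSeries.X j)
  have hA : A.mulVec (fun j => pderiv ℂ j F) = F • χ := by
    funext i
    rw [Pi.smul_apply, smul_eq_mul, mul_comm, ← hχ, derivation_apply_eq_sum (δ i) F]
    rfl
  have hgrad : ∀ j, pderiv ℂ j F ∈ maxIdeal n ^ k := by
    intro j
    -- Multiplying A∇F = Fχ by the adjugate and cancelling F, which is det A up to a unit, expresses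
    -- ∇F through χ.
    have h1 : A.det • (fun j => pderiv ℂ j F) = F • A.adjugate.mulVec χ := by
      rw [← Matrix.mulVec_smul, ← hA, Matrix.mulVec_mulVec, Matrix.adjugate_mul,
        Matrix.smul_mulVec, Matrix.one_mulVec]
    have h2 := congrFun h1 j
    rw [Pi.smul_apply, Pi.smul_apply, smul_eq_mul, smul_eq_mul, hu, hfF] at h2
    have h3 : (u : FormalRing n) * ↑v⁻¹ * pderiv ℂ j F = A.adjugate.mulVec χ j := by
      apply mul_left_cancel₀ hF0
      rw [← h2]
      ring
    have h4 : A.adjugate.mulVec χ j ∈ maxIdeal n ^ k :=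
      Ideal.sum_mem _ (t := Finset.univ) (f := fun i => A.adjugate j i * χ i)
        fun i _ => Ideal.mul_mem_left _ _ (hχk i)
    rw [← h3, ← Units.val_mul] at h4
    exact (Ideal.unit_mul_mem_iff_mem _ (u * v⁻¹).isUnit).mp h4
  have hFk : F ∈ maxIdeal n ^ k := by
    rw [mem_maximalIdeal_pow_iff]
    intro d hd
    by_cases hd0 : d = 0
    · have hFm : F ∈ maxIdeal n := by
        rw [← hv]
        exact Ideal.mul_mem_right _ _ (mem_maxIdeal_of_not_isProduct hn hf)
      rw [hd0]
      exact mem_maximalIdeal_iff.mp hFm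
    · exact coeff_eq_zero_of_pderiv_mem_pow hgrad hd0 hd.le
  rw [hfF]
  exact Ideal.mul_mem_right _ _ hFk

end Semiinvariant

/-- If `f` is free in at most three variables and not a product, then the Lie algebra
`Der_f / 𝔪 Der_f` is solvable. -/
theorem isSolvable_truncated_one (hn : n ≤ 3) (hfree : IsFree f) (hf : ¬ IsProduct f) :
    LieAlgebra.IsSolvable (Truncated f hf 1) := by
  obtain ⟨hsq, δ, hδ, u, hu⟩ := hfree
  have hspan := logModule_eq_span hsq hδ hu
  have hfin := finiteDimensional_truncated_one hf hδ hspan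
  have hrank := finrank_truncated_one_le hf hδ hspan
  by_contra hs
  obtain ⟨h3, hperf⟩ := LieAlgebra.finrank_eq_three_of_not_isSolvable (K := ℂ)
    (hrank.trans hn) hs
  refine not_forall_exists_associated_cofactor_mem_pow (by omega) hsq.ne_zero hf hu fun k => ?_
  obtain ⟨F, hF, χ, hχ, hχk⟩ := exists_associated_cofactor_mem_pow hsq.ne_zero hf
    (finBasisOfFinrankEq ℂ _ h3) hperf k
  exact ⟨F, hF, fun i => χ ⟨δ i, hδ i⟩, fun i => hχ ⟨δ i, hδ i⟩, fun i => hχk _⟩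

end FormalDer

theorem proposition29 (n : ℕ) (hn : n ≤ 3) (f : FormalRing n) (hfree : FormalDer.IsFree f)
    (hprod : ¬ FormalDer.IsProduct f) (d : ℕ) (hd : 1 ≤ d) :
    LieAlgebra.IsSolvable (FormalDer.Truncated f hprod d) := by
  obtain ⟨e, rfl⟩ := Nat.exists_eq_add_of_le' hd
  exact FormalDer.isSolvable_truncated_of_isSolvable_truncated_one hprod
    (FormalDer.isSolvable_truncated_one hn hfree hprod) e
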